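/- Theorem 4.2. Let $2^{\mathbb N}$ be the space of infinite binary sequences with its Borel $\sigma$-algebra, let $T$ be the left shift, $(T\omega)(n)=\omega(n+1)$, and for a finite binary sequence $\sigma$ let $[\sigma]$ be the set of $\omega\in 2^{\mathbb N}$ that extend $\sigma$. A *representation* of a probability measure $\mu$ on $2^{\mathbb N}$ is a function $r$ that assigns to each finite binary sequence $\sigma$ and each $i\in\mathbb N$ a rational $r(\sigma,i)$ with $|\mu([\sigma])-r(\sigma,i)|<2^{-i}$; $\mu$ is *computable* if it has a computable representation. A point $\omega\in 2^{\mathbb N}$ is *generic* for $\mu$ if $\lim_{n\to\infty}\frac1n\sum_{i<n}1_{[\sigma]}(T^i\omega)=\mu([\sigma])$ for every finite binary sequence $\sigma$. Then there are a computable function $m(j,\varepsilon)$ of $j\in\mathbb N$ and $\varepsilon\in\mathbb Q$, with values in $\mathbb N$, and a single oracle algorithm with the following property. For every shift-invariant probability measure $\mu$ on $2^{\mathbb N}$ and every representation of $\mu$, the algorithm, with this representation as its oracle, computes (bit by bit) a point $\omega\in 2^{\mathbb N}$ that is generic for $\mu$ and that satisfies $$\Bigl|\mu([\sigma])-\frac1n\sum_{i<n}1_{[\sigma]}(T^i\omega)\Bigr|<\varepsilon$$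 for every $j\in\mathbb N$, every $\sigma$ of length $j$, every rational $\varepsilon>0$ and every $n\ge m(j,\varepsilon)$. (Neither $m$ nor the algorithm depends on $\mu$.) In particular, every computable shift-invariant probability measure on $2^{\mathbb N}$ has a computable generic point. -/

import Mathlib

namespace CantorGeneric

open Filter Topology MeasureTheory

/-! Cantor space `2^ℕ` is `ℕ → Bool`, with the product (= Borel) `σ`-algebra. -/

/-- The cylinder `[σ]`: the infinite binary sequences that extend the finite sequence `σ`. -/
def cylinder (σ : List Bool) : Set (ℕ → Bool) :=
  {ω | ∀ (i : ℕ) (h : i < σ.length), ω i = σ[i]}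

/-- The left shift `T` on Cantor space. -/
def shift (ω : ℕ → Bool) : ℕ → Bool := fun n => ω (n + 1)

/-- The empirical frequency `(1/n) ∑_{i < n} 1_{[σ]} (T^i ω)`. -/
noncomputable def freq (σ : List Bool) (ω : ℕ → Bool) (n : ℕ) : ℝ :=
  (1 / (n : ℝ)) * ∑ i ∈ Finset.range n, (cylinder σ).indicator (fun _ => (1 : ℝ)) (shift^[i] ω)

/-- `ω` is generic for `μ`: every finite binary sequence `σ` occurs in `ω` with limiting
frequency `μ [σ]`. -/
def IsGeneric (μ : Measure (ℕ → Bool)) (ω : ℕ → Bool) : Prop :=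
  ∀ σ : List Bool, Tendsto (freq σ ω) atTop (𝓝 (μ.real (cylinder σ)))

/-- The standard numbering of the rationals: a natural number codes a pair `(a, b)` of an integer
and a natural number, which in turn denotes the rational `a / (b + 1)`. -/
def ratOfNat (e : ℕ) : ℚ :=
  ((Denumerable.ofNat (ℤ × ℕ) e).1 : ℚ) / ((Denumerable.ofNat (ℤ × ℕ) e).2 + 1)

/-- `r` represents `μ`: `r (σ, i)` is a rational approximation of `μ [σ]` to within `2^{-i}`. -/
def Represents (r : List Bool × ℕ → ℚ) (μ : Measure (ℕ → Bool)) : Prop :=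
  ∀ (σ : List Bool) (i : ℕ), |μ.real (cylinder σ) - (r (σ, i) : ℝ)| < (2 : ℝ)⁻¹ ^ i

/-- The function `o` on natural numbers encodes the rational-valued function `r` on pairs
`(σ, i)`: on the code of an argument it returns a code of the value. -/
def Encodes (o : ℕ → ℕ) (r : List Bool × ℕ → ℚ) : Prop :=
  ∀ x : List Bool × ℕ, ratOfNat (o (Encodable.encode x)) = r x

/-- A measure is computable if it has a computable representation. -/
def ComputableMeasure (μ : Measure (ℕ → Bool)) : Prop :=
  ∃ r : List Bool × ℕ → ℚ, Represents r μ ∧ ∃ o : ℕ → ℕ, Computable o ∧ Encodes o r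

/-- Partial recursive functionals, i.e. the input-output behaviours of oracle algorithms.
`F o n` is the outcome of one fixed algorithm on input `n` with oracle `o : ℕ → ℕ` (undefined if
the algorithm diverges). This is Mathlib's `Nat.RecursiveIn {o}`, except that the same program has
to be used for every oracle `o`. -/
inductive OracleAlgorithm : ((ℕ → ℕ) → ℕ →. ℕ) → Prop
  | zero : OracleAlgorithm fun _ _ => Part.some 0
  | succ : OracleAlgorithm fun _ n => Part.some (n + 1)
  | left : OracleAlgorithm fun _ n => Part.some (Nat.unpair n).1
  | right : OracleAlgorithm fun _ n => Part.some (Nat.unpair n).2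
  /-- Query the oracle. -/
  | oracle : OracleAlgorithm fun o n => Part.some (o n)
  | pair {F G : (ℕ → ℕ) → ℕ →. ℕ} (hF : OracleAlgorithm F) (hG : OracleAlgorithm G) :
      OracleAlgorithm fun o n => Nat.pair <$> F o n <*> G o n
  | comp {F G : (ℕ → ℕ) → ℕ →. ℕ} (hF : OracleAlgorithm F) (hG : OracleAlgorithm G) :
      OracleAlgorithm fun o n => G o n >>= F o
  | prec {F G : (ℕ → ℕ) → ℕ →. ℕ} (hF : OracleAlgorithm F) (hG : OracleAlgorithm G) :
      OracleAlgorithm fun o p =>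
        let (a, n) := Nat.unpair p
        n.rec (F o a) fun y IH => do
          let i ← IH
          G o (Nat.pair a (Nat.pair y i))
  | rfind {F : (ℕ → ℕ) → ℕ →. ℕ} (hF : OracleAlgorithm F) :
      OracleAlgorithm fun o a =>
        Nat.rfind fun n => (fun m => m = 0) <$> F o (Nat.pair a n)

/-- With oracle `o`, the algorithm `F` computes the point `ω`: on every input `i` it halts and
returns the `i`-th bit of `ω`. -/
def ComputesPoint (F : (ℕ → ℕ) → ℕ →. ℕ) (o : ℕ → ℕ) (ω : ℕ → Bool) : Prop :=
  ∀ i : ℕ, F o i = Part.some (ω i).toNat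

end CantorGeneric

namespace CantorGeneric

open Filter Topology MeasureTheory

/-! No ergodic theorem is needed, because invariance already fixes the mean frequency. Let `k` be
the length of `σ` and draw a word of length `N` from `μ`. Its expected number of occurrences of `σ`
is `N * μ[σ]` up to an error of `k`, caused by occurrences that run past the end of the word
(`abs_mean_disc_le`). A finite word that contains each word `u` of length `N` about `4 ^ N * μ[u]`
times therefore has the right frequency of `σ`. The `2 ^ N` rounding errors are negligible against
`4 ^ N`, and the cuts between words cost at most `k` per word of length `N`. The error per letter is
thus of order `(k + 1) / N` (`abs_disc_block_add_le`).

The oracle gives the multiplicities to sufficient precision. Padding or truncating makes the block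
lengths independent of the oracle. The point is the concatenation of the blocks, block `t` being
repeated as many times as block `t + 1` has letters. At any time the unfinished copy of a block is
then short compared with what precedes it, and the early, inaccurate part is eventually diluted
(`abs_disc_firstBits_point_le`).

All constants depend only on `k` and the fixed lengths, so one explicit modulus serves every `μ`
(`abs_measure_sub_freq_point_lt`). Genericity follows from it, and a computable oracle turns the
algorithm into a recursive function. -/

/-! ### Oracle algorithms and computable functions -/

/-- A function that is computable without the oracle is computed by an oracle algorithm. -/
theorem OracleAlgorithm.of_partrec {g : ℕ →. ℕ} (hg : Nat.Partrec g) :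
    OracleAlgorithm fun _ => g := by
  induction hg with
  | zero => exact .zero
  | succ => exact .succ
  | left => exact .left
  | right => exact .right
  | pair _ _ hF hG => exact .pair hF hG
  | comp _ _ hF hG => exact .comp hF hG
  | prec _ _ hF hG => exact .prec hF hG
  | rfind _ hF => exact .rfind hF

/-- An oracle algorithm with a computable oracle computes a partial recursive function. -/
theorem OracleAlgorithm.partrec {F : (ℕ → ℕ) → ℕ →. ℕ} (hF : OracleAlgorithm F) {o : ℕ → ℕ}
    (ho : Computable o) : Nat.Partrec (F o) := by
  induction hF with
  | zero => exact .zero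
  | succ => exact .succ
  | left => exact .left
  | right => exact .right
  | oracle => exact Partrec.nat_iff.1 ho
  | pair _ _ hF hG => exact .pair hF hG
  | comp _ _ hF hG => exact .comp hF hG
  | prec _ _ hF hG => exact .prec hF hG
  | rfind _ hF => exact .rfind hF

/-- Total functions between encoded types that are computed by one oracle algorithm, uniformly
in the oracle. -/
def OracleComputable {α β : Type*} [Primcodable α] [Primcodable β]
    (f : (ℕ → ℕ) → α → β) : Prop :=
  ∃ F, OracleAlgorithm F ∧ ∀ o a, F o (Encodable.encode a) = Part.some (Encodable.encode (f o a))

namespace OracleComputable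

variable {α β γ : Type*} [Primcodable α] [Primcodable β] [Primcodable γ]

theorem of_computable {f : α → β} (hf : Computable f) : OracleComputable fun _ => f :=
  ⟨_, .of_partrec hf, fun o a => by simp⟩

theorem of_primrec {f : α → β} (hf : Primrec f) : OracleComputable fun _ => f :=
  of_computable hf.to_comp

theorem oracle : OracleComputable fun o n => o n :=
  ⟨_, .oracle, fun o a => by simp⟩

theorem comp {g : (ℕ → ℕ) → β → γ} {f : (ℕ → ℕ) → α → β} (hg : OracleComputable g)
    (hf : OracleComputable f) : OracleComputable fun o a => g o (f o a) := by
  obtain ⟨G, hG, hGg⟩ := hg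
  obtain ⟨F, hF, hFf⟩ := hf
  exact ⟨_, .comp hG hF, fun o a => by
    rw [hFf]
    exact (Part.bind_some _ _).trans (hGg o (f o a))⟩

theorem pair {f : (ℕ → ℕ) → α → β} {g : (ℕ → ℕ) → α → γ} (hf : OracleComputable f)
    (hg : OracleComputable g) : OracleComputable fun o a => (f o a, g o a) := by
  obtain ⟨G, hG, hGg⟩ := hg
  obtain ⟨F, hF, hFf⟩ := hf
  exact ⟨_, .pair hF hG, fun o a => by simp [hFf, hGg, Seq.seq]⟩

theorem nat_rec {f : (ℕ → ℕ) → α → β} {g : (ℕ → ℕ) → α × ℕ × β → β} (hf : OracleComputable f)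
    (hg : OracleComputable g) :
    OracleComputable fun o (p : α × ℕ) =>
      (Nat.rec (f o p.1) (fun y b => g o (p.1, y, b)) p.2 : β) := by
  obtain ⟨G, hG, hGg⟩ := hg
  obtain ⟨F, hF, hFf⟩ := hf
  refine ⟨_, .prec hF hG, fun o ⟨a, n⟩ => ?_⟩
  simp only [Encodable.encode_prod_val, Nat.unpair_pair, Encodable.encode_nat]
  induction n with
  | zero => simp [hFf]
  | succ n ih =>
    have := hGg o (a, n, Nat.rec (f o a) (fun y b => g o (a, y, b)) n)
    simp only [Encodable.encode_prod_val, Encodable.encode_nat] at this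
    simp only [ih]
    simpa using this

/-- Primitive recursion on the number of entries already processed. The list itself does not depend
on the oracle; only the images of its entries do. -/
theorem list_flatMap [Inhabited β] {l : α → List β} {h : (ℕ → ℕ) → α × β → List γ}
    (hl : Computable l) (hh : OracleComputable h) :
    OracleComputable fun o a => (l a).flatMap fun b => h o (a, b) := by
  have hstep : OracleComputable fun o (q : α × ℕ × List γ) =>
      q.2.2 ++ h o (q.1, (l q.1).getD q.2.1 default) := by
    have hq : OracleComputable fun _ (q : α × ℕ × List γ) =>
        (q.1, (l q.1).getD q.2.1 default) :=
      of_computable <| Computable.fst.pair <|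
        (Primrec.list_getD default).to_comp.comp (hl.comp Computable.fst)
          (Computable.fst.comp Computable.snd)
    have happ : OracleComputable fun _ (q : List γ × List γ) => q.1 ++ q.2 :=
      of_primrec Primrec.list_append
    exact happ.comp
      ((of_primrec (Primrec.snd.comp Primrec.snd)).pair (hh.comp hq))
  have hinit : OracleComputable fun _ (_ : α) => ([] : List γ) := of_primrec (Primrec.const _)
  have hlen : OracleComputable fun _ (a : α) => (a, (l a).length) :=
    of_computable (Computable.id.pair (Primrec.list_length.to_comp.comp hl))
  -- All indices stay below the length of the list, so the default entry is never used.
  have key : ∀ (o : ℕ → ℕ) (a : α) (n : ℕ), n ≤ (l a).length →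
      (Nat.rec [] (fun y b => b ++ h o (a, (l a).getD y default)) n : List γ) =
        ((l a).take n).flatMap fun b => h o (a, b) := by
    intro o a n hn
    induction n with
    | zero => simp
    | succ n ih =>
      simp only [ih (by omega)]
      rw [List.take_succ_eq_append_getElem (by omega), List.flatMap_append,
        List.flatMap_singleton, List.getD_eq_getElem]
  convert (hinit.nat_rec hstep).comp hlen using 3 with o a
  simp only [key o a _ le_rfl, List.take_length]

end OracleComputable

/-! ### The construction of the point -/

/-- All binary words of length `N`. -/
def words : ℕ → List (List Bool)
  | 0 => [[]]
  | N + 1 => (words N).map (List.cons false) ++ (words N).map (List.cons true)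

/-- The numerator of the positive part of the rational with code `e`. -/
def codeNum (e : ℕ) : ℕ := if e.unpair.1 % 2 = 0 then e.unpair.1 / 2 else 0

/-- A denominator of the rational with code `e`. -/
def codeDen (e : ℕ) : ℕ := e.unpair.2 + 1

/-- The `n`-fold repetition of a list. -/
def listRepeat {α : Type*} (n : ℕ) (l : List α) : List α := (List.range n).flatMap fun _ => l

/-- The multiplicity `⌊4 ^ N * q⌋₊`, where `q` is the approximation of the measure of `[u]` within
`4⁻¹ ^ N` given by the oracle. -/
def multiplicity (o : ℕ → ℕ) (N : ℕ) (u : List Bool) : ℕ :=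
  4 ^ N * codeNum (o (Encodable.encode (u, 2 * N))) / codeDen (o (Encodable.encode (u, 2 * N)))

/-- The concatenation of all words of length `N`, repeated according to their multiplicities. -/
def sample (o : ℕ → ℕ) (N : ℕ) : List Bool :=
  (words N).flatMap fun u => listRepeat (multiplicity o N u) u

/-- With `N = t + 1`, this is the length of `4 ^ N` words of length `N`, the ideal length of the
sample. Fixing it independently of the oracle keeps the modulus independent of the measure. -/
def blockLength (t : ℕ) : ℕ := (t + 1) * 4 ^ (t + 1)

/-- The sample of order `t + 1`, truncated or padded to the length `blockLength t`. -/
def block (o : ℕ → ℕ) (t : ℕ) : List Bool :=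
  (List.range (blockLength t)).map fun i => (sample o (t + 1)).getD i false

/-- The initial segments of the constructed point. -/
def initialWord (o : ℕ → ℕ) : ℕ → List Bool
  | 0 => []
  | t + 1 => initialWord o t ++ listRepeat (blockLength (t + 1)) (block o t)

def initialLength : ℕ → ℕ
  | 0 => 0
  | t + 1 => initialLength t + blockLength (t + 1) * blockLength t

/-- The point computed from a representation of a measure. -/
def point (o : ℕ → ℕ) (n : ℕ) : Bool := (initialWord o (n + 1)).getD n false

/-! ### Computability of the construction, uniformly in the oracle. -/

theorem primrec_pow (b : ℕ) : Primrec fun n : ℕ => b ^ n :=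
  (Primrec.nat_rec₁ 1 (f := fun _ y => y * b)
    (Primrec.nat_mul.comp Primrec.snd (Primrec.const b))).of_eq fun n => by
      induction n with
      | zero => rfl
      | succ n ih => rw [pow_succ, ← ih]

theorem primrec_words : Primrec words :=
  (Primrec.nat_rec₁ [[]]
    (f := fun _ l => l.map (List.cons false) ++ l.map (List.cons true))
    (Primrec.list_append.comp
      (Primrec.list_map Primrec.snd (Primrec.list_cons.comp (Primrec.const _) Primrec.snd).to₂)
      (Primrec.list_map Primrec.snd
        (Primrec.list_cons.comp (Primrec.const _) Primrec.snd).to₂))).of_eq fun n => by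
    induction n with
    | zero => rfl
    | succ n ih => simp only [words, ← ih]

theorem primrec_codeNum : Primrec codeNum :=
  have h : Primrec fun e : ℕ => e.unpair.1 := Primrec.fst.comp Primrec.unpair
  Primrec.ite
    (Primrec.eq.comp (Primrec.nat_mod.comp h (Primrec.const 2)) (Primrec.const 0))
    (Primrec.nat_div.comp h (Primrec.const 2)) (Primrec.const 0)

theorem primrec_codeDen : Primrec codeDen :=
  Primrec.succ.comp (Primrec.snd.comp Primrec.unpair)

theorem primrec_listRepeat {α : Type*} [Primcodable α] :
    Primrec₂ (listRepeat : ℕ → List α → List α) :=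
  Primrec.list_flatMap (Primrec.list_range.comp Primrec.fst)
    (Primrec.snd.comp Primrec.fst).to₂

theorem primrec_blockLength : Primrec blockLength :=
  Primrec.nat_mul.comp Primrec.succ ((primrec_pow 4).comp Primrec.succ)

theorem primrec_initialLength : Primrec initialLength :=
  (Primrec.nat_rec₁ 0 (f := fun t y => y + blockLength (t + 1) * blockLength t)
    (Primrec.nat_add.comp Primrec.snd
      (Primrec.nat_mul.comp (primrec_blockLength.comp (Primrec.succ.comp Primrec.fst))
        (primrec_blockLength.comp Primrec.fst)))).of_eq fun n => by
      induction n with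
      | zero => rfl
      | succ n ih => simp only [initialLength, ← ih]

theorem oracleComputable_sample : OracleComputable sample := by
  have hquery : OracleComputable fun _ (q : ℕ × List Bool) =>
      Encodable.encode (q.2, 2 * q.1) :=
    .of_primrec <| Primrec.encode.comp <| Primrec.snd.pair <|
      Primrec.nat_mul.comp (Primrec.const 2) Primrec.fst
  have hrep : OracleComputable fun _ (q : (ℕ × List Bool) × ℕ) =>
      listRepeat (4 ^ q.1.1 * codeNum q.2 / codeDen q.2) q.1.2 :=
    .of_primrec <| primrec_listRepeat.comp
      (Primrec.nat_div.comp
        (Primrec.nat_mul.comp ((primrec_pow 4).comp (Primrec.fst.comp Primrec.fst))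
          (primrec_codeNum.comp Primrec.snd))
        (primrec_codeDen.comp Primrec.snd))
      (Primrec.snd.comp Primrec.fst)
  exact OracleComputable.list_flatMap primrec_words.to_comp
    (hrep.comp ((OracleComputable.of_primrec Primrec.id).pair
      (OracleComputable.oracle.comp hquery)))

theorem oracleComputable_block : OracleComputable block := by
  have hpad : OracleComputable fun _ (q : ℕ × List Bool) =>
      (List.range (blockLength q.1)).map fun i => q.2.getD i false :=
    .of_primrec <| Primrec.list_map
      (Primrec.list_range.comp (primrec_blockLength.comp Primrec.fst))
      ((Primrec.list_getD false).comp (Primrec.snd.comp Primrec.fst) Primrec.snd).to₂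
  exact hpad.comp ((OracleComputable.of_primrec Primrec.id).pair
    (oracleComputable_sample.comp (.of_primrec Primrec.succ)))

theorem oracleComputable_initialWord : OracleComputable initialWord := by
  have hinit : OracleComputable fun _ (_ : Unit) => ([] : List Bool) :=
    .of_primrec (Primrec.const _)
  have happ : OracleComputable fun _ (q : (Unit × ℕ × List Bool) × List Bool) =>
      q.1.2.2 ++ listRepeat (blockLength (q.1.2.1 + 1)) q.2 :=
    .of_primrec <| Primrec.list_append.comp
      (Primrec.snd.comp (Primrec.snd.comp Primrec.fst))
      (primrec_listRepeat.comp
        (primrec_blockLength.comp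
          (Primrec.succ.comp (Primrec.fst.comp (Primrec.snd.comp Primrec.fst))))
        Primrec.snd)
  have hstep : OracleComputable fun o (q : Unit × ℕ × List Bool) =>
      q.2.2 ++ listRepeat (blockLength (q.2.1 + 1)) (block o q.2.1) :=
    happ.comp ((OracleComputable.of_primrec Primrec.id).pair
      (oracleComputable_block.comp (.of_primrec (Primrec.fst.comp Primrec.snd))))
  have hrec := (hinit.nat_rec hstep).comp
    (.of_primrec (f := fun n : ℕ => ((), n)) ((Primrec.const ()).pair Primrec.id))
  convert hrec using 3 with o n
  induction n with
  | zero => rfl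
  | succ n ih => simp only [initialWord, ← ih]

theorem oracleComputable_point : OracleComputable point := by
  have hget : OracleComputable fun _ (q : ℕ × List Bool) => q.2.getD q.1 false :=
    .of_primrec ((Primrec.list_getD false).comp Primrec.snd Primrec.fst)
  exact hget.comp ((OracleComputable.of_primrec Primrec.id).pair
    (oracleComputable_initialWord.comp (.of_primrec Primrec.succ)))

theorem exists_oracleAlgorithm_point :
    ∃ F, OracleAlgorithm F ∧ ∀ o, ComputesPoint F o (point o) := by
  obtain ⟨F, hF, h⟩ := oracleComputable_point
  refine ⟨F, hF, fun o i => ?_⟩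
  have := h o i
  rw [Encodable.encode_nat] at this
  rw [this]
  cases point o i <;> rfl

/-- A point computed by an oracle algorithm from a computable oracle is computable. -/
theorem ComputesPoint.computable {F : (ℕ → ℕ) → ℕ →. ℕ} {o : ℕ → ℕ} {ω : ℕ → Bool}
    (h : ComputesPoint F o ω) (hF : OracleAlgorithm F) (ho : Computable o) : Computable ω := by
  have hnat : Computable fun i => (ω i).toNat :=
    (Partrec.nat_iff.2 (hF.partrec ho)).of_eq h
  exact ((Primrec.eq.decide.comp Primrec.id (Primrec.const 1)).to_comp.comp hnat).of_eq
    fun i => by cases ω i <;> simp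

/-! ### Codes of rationals -/

theorem ratOfNat_eq (e : ℕ) :
    ratOfNat e = ((Denumerable.ofNat ℤ e.unpair.1 : ℤ) : ℚ) / (codeDen e : ℚ) := by
  simp [ratOfNat, codeDen]

theorem toNat_ofNat_int (n : ℕ) :
    (Denumerable.ofNat ℤ n).toNat = if n % 2 = 0 then n / 2 else 0 := by
  -- Even codes `2 * k` stand for `k`, odd codes `2 * k + 1` for `-(k + 1)`.
  change (Equiv.intEquivNat.symm n).toNat = _
  rcases Nat.even_or_odd' n with ⟨k, rfl | rfl⟩
  · have : Equiv.intEquivNat.symm (2 * k) = (k : ℤ) := by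
      rw [Equiv.symm_apply_eq]; rfl
    simp [this]
  · have : Equiv.intEquivNat.symm (2 * k + 1) = Int.negSucc k := by
      rw [Equiv.symm_apply_eq]; rfl
    simp [this, Nat.add_mod]

theorem codeNum_eq (e : ℕ) : codeNum e = (Denumerable.ofNat ℤ e.unpair.1).toNat :=
  (toNat_ofNat_int _).symm

theorem codeDen_pos (e : ℕ) : 0 < codeDen e := Nat.succ_pos _

theorem max_ratOfNat_zero (e : ℕ) : max (ratOfNat e) 0 = (codeNum e : ℚ) / codeDen e := by
  have hd : (0 : ℚ) < codeDen e := by exact_mod_cast codeDen_pos e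
  have h : (codeNum e : ℚ) = max ((Denumerable.ofNat ℤ e.unpair.1 : ℤ) : ℚ) 0 := by
    rw [codeNum_eq]
    exact_mod_cast congrArg (Int.cast : ℤ → ℚ) (Int.toNat_eq_max (Denumerable.ofNat ℤ e.unpair.1))
  rw [ratOfNat_eq, h, ← max_div_div_right hd.le, zero_div]

/-- Reduces the modulus to a division of natural numbers. For a nonpositive rational both sides are
`0`, by the conventions for division by zero and for the floor. -/
theorem floor_inv_ratOfNat (e : ℕ) : ⌊(ratOfNat e)⁻¹⌋₊ = codeDen e / codeNum e := by
  rcases le_or_gt (ratOfNat e) 0 with h | h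
  · have hd : (codeDen e : ℚ) ≠ 0 := by exact_mod_cast (codeDen_pos e).ne'
    have h0 := max_ratOfNat_zero e
    rw [max_eq_right h, eq_comm, div_eq_zero_iff, or_iff_left hd, Nat.cast_eq_zero] at h0
    rw [h0, Nat.div_zero, Nat.floor_of_nonpos (inv_nonpos.2 h)]
  · rw [← max_eq_left h.le, max_ratOfNat_zero, inv_div, Nat.floor_div_eq_div]

/-! ### Occurrences of a word in a finite word -/

/-- The number of occurrences of `σ` in a finite word. -/
def occ (σ : List Bool) : List Bool → ℕ
  | [] => 0
  | b :: x => (if σ <+: b :: x then 1 else 0) + occ σ x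

/-- The deviation of the number of occurrences of `σ` in `x` from `p` times the length of `x`. -/
def disc (σ : List Bool) (p : ℝ) (x : List Bool) : ℝ := occ σ x - x.length * p

theorem occ_le_length (σ x : List Bool) : occ σ x ≤ x.length := by
  induction x with
  | nil => simp [occ]
  | cons b x ih => simp only [occ, List.length_cons]; split_ifs <;> omega

theorem occ_add_le (σ x y : List Bool) : occ σ x + occ σ y ≤ occ σ (x ++ y) := by
  induction x with
  | nil => simp [occ]
  | cons b x ih =>
    have h : σ <+: b :: x → σ <+: b :: (x ++ y) := fun h => h.trans (List.prefix_append (b :: x) y)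
    simp only [occ, List.cons_append]
    split_ifs <;> first | omega | tauto

/-- An occurrence that is not counted in `x` or `y` starts in one of the last `σ.length` places of
`x`. The minimum is what lets the induction on `x` close. -/
theorem occ_append_le (σ x y : List Bool) :
    occ σ (x ++ y) ≤ occ σ x + occ σ y + min x.length σ.length := by
  induction x with
  | nil => simp [occ]
  | cons b x ih =>
    simp only [occ, List.cons_append, List.length_cons]
    rcases lt_or_ge x.length σ.length with h | h
    · rw [min_eq_left (by omega)] at ih ⊢
      split_ifs <;> omega
    · rw [min_eq_right (by omega)] at ih
      rw [min_eq_right (by omega)]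
      have h : σ <+: b :: (x ++ y) → σ <+: b :: x := fun h' =>
        List.prefix_of_prefix_length_le h' (List.prefix_append (b :: x) y) (by simp; omega)
      split_ifs <;> first | omega | tauto

theorem abs_disc_le_length (σ : List Bool) {p : ℝ} (h0 : 0 ≤ p) (h1 : p ≤ 1) (x : List Bool) :
    |disc σ p x| ≤ x.length := by
  have h : (occ σ x : ℝ) ≤ x.length := by exact_mod_cast occ_le_length σ x
  have h' : (x.length : ℝ) * p ≤ x.length := mul_le_of_le_one_right (by positivity) h1
  have h'' : 0 ≤ (x.length : ℝ) * p := by positivity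
  have h3 : (0 : ℝ) ≤ occ σ x := by positivity
  rw [disc, abs_le]
  constructor <;> linarith

/-- Only occurrences across the junction spoil additivity. All estimates for concatenations rest on
this bound. -/
theorem abs_disc_append_sub (σ : List Bool) (p : ℝ) (x y : List Bool) :
    |disc σ p (x ++ y) - (disc σ p x + disc σ p y)| ≤ σ.length := by
  have h1 : (occ σ x + occ σ y : ℝ) ≤ occ σ (x ++ y) := by exact_mod_cast occ_add_le σ x y
  have h2 : (occ σ (x ++ y) : ℝ) ≤ occ σ x + occ σ y + σ.length := by
    exact_mod_cast (occ_append_le σ x y).trans (Nat.add_le_add_left (min_le_right _ _) _)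
  simp only [disc, List.length_append, Nat.cast_add]
  rw [abs_le]
  constructor <;> linarith

theorem abs_disc_append_le (σ : List Bool) (p : ℝ) (x y : List Bool) :
    |disc σ p (x ++ y)| ≤ |disc σ p x| + |disc σ p y| + σ.length := by
  have h := abs_disc_append_sub σ p x y
  have h1 := abs_add_le (disc σ p (x ++ y) - (disc σ p x + disc σ p y)) (disc σ p x + disc σ p y)
  have h2 := abs_add_le (disc σ p x) (disc σ p y)
  rw [sub_add_cancel] at h1
  linarith

theorem abs_disc_left_le (σ : List Bool) (p : ℝ) (x y : List Bool) :
    |disc σ p x| ≤ |disc σ p (x ++ y)| + |disc σ p y| + σ.length := by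
  have h := abs_le.1 (abs_disc_append_sub σ p x y)
  have h1 := abs_le.1 (le_refl |disc σ p (x ++ y)|)
  have h2 := abs_le.1 (le_refl |disc σ p y|)
  rw [abs_le]
  constructor <;> linarith

section listRepeat

variable {α : Type*}

theorem listRepeat_zero (l : List α) : listRepeat 0 l = [] := rfl

theorem listRepeat_succ (n : ℕ) (l : List α) : listRepeat (n + 1) l = l ++ listRepeat n l := by
  simp [listRepeat, List.range_succ_eq_map, List.flatMap_map]

theorem listRepeat_succ' (n : ℕ) (l : List α) : listRepeat (n + 1) l = listRepeat n l ++ l := by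
  simp [listRepeat, List.range_succ]

theorem length_listRepeat (n : ℕ) (l : List α) : (listRepeat n l).length = n * l.length := by
  simp [listRepeat]

/-- An initial segment of a repeated list consists of full copies and a part of one copy. -/
theorem exists_take_listRepeat (l : List α) (a n : ℕ) :
    ∃ q b, (listRepeat a l).take n = listRepeat q l ++ l.take b := by
  induction a generalizing n with
  | zero => exact ⟨0, 0, by simp [listRepeat_zero]⟩
  | succ a ih =>
    rcases le_total n l.length with h | h
    · exact ⟨0, n, by simp [listRepeat_succ, listRepeat_zero, List.take_append_of_le_length h]⟩
    · obtain ⟨q, b, hqb⟩ := ih (n - l.length)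
      exact ⟨q + 1, b, by rw [listRepeat_succ, listRepeat_succ, List.take_append, hqb,
        List.take_of_length_le h, List.append_assoc]⟩

end listRepeat

theorem abs_disc_listRepeat_append_sub (σ : List Bool) (p : ℝ) (c : ℕ) (u y : List Bool) :
    |disc σ p (listRepeat c u ++ y) - (c * disc σ p u + disc σ p y)| ≤ c * σ.length := by
  induction c with
  | zero => simp [listRepeat_zero]
  | succ c ih =>
    have h := abs_disc_append_sub σ p u (listRepeat c u ++ y)
    rw [listRepeat_succ, List.append_assoc]
    push_cast
    rw [abs_le] at *
    constructor <;> linarith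

theorem abs_disc_append_listRepeat_le (σ : List Bool) (p : ℝ) (c : ℕ) (x v : List Bool) :
    |disc σ p (x ++ listRepeat c v)| ≤ |disc σ p x| + c * (|disc σ p v| + σ.length) := by
  induction c with
  | zero => simp [listRepeat_zero]
  | succ c ih =>
    have h := abs_disc_append_le σ p (x ++ listRepeat c v) v
    rw [listRepeat_succ', ← List.append_assoc]
    push_cast
    linarith

/-- A concatenation of repeated words has the deviation expected from its multiplicities, up to
the occurrences that are cut. -/
theorem abs_disc_flatMap_listRepeat_sub (σ : List Bool) (p : ℝ) (c : List Bool → ℕ)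
    (l : List (List Bool)) :
    |disc σ p (l.flatMap fun u => listRepeat (c u) u) - (l.map fun u => c u * disc σ p u).sum| ≤
      (l.map fun u => (c u : ℝ)).sum * σ.length := by
  induction l with
  | nil => simp [disc, occ]
  | cons u l ih =>
    have h := abs_disc_listRepeat_append_sub σ p (c u) u (l.flatMap fun u => listRepeat (c u) u)
    simp only [List.flatMap_cons, List.map_cons, List.sum_cons]
    rw [abs_le] at *
    constructor <;> linarith

theorem length_flatMap_listRepeat {N : ℕ} (c : List Bool → ℕ) {l : List (List Bool)}
    (hl : ∀ u ∈ l, u.length = N) :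
    ((l.flatMap fun u => listRepeat (c u) u).length : ℝ) =
      (l.map fun u => (c u : ℝ)).sum * N := by
  induction l with
  | nil => simp
  | cons u l ih =>
    simp only [List.flatMap_cons, List.length_append, List.map_cons, List.sum_cons, Nat.cast_add,
      ih fun v hv => hl v (List.mem_cons_of_mem _ hv), length_listRepeat,
      hl u List.mem_cons_self]
    push_cast
    ring

theorem abs_list_sum_le {α : Type*} {l : List α} {f : α → ℝ} {B : ℝ} (h : ∀ u ∈ l, |f u| ≤ B) :
    |(l.map f).sum| ≤ l.length * B := by
  induction l with
  | nil => simp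
  | cons u l ih =>
    have h1 := h u List.mem_cons_self
    have h2 := ih fun v hv => h v (List.mem_cons_of_mem _ hv)
    have h3 := abs_add_le (f u) (l.map f).sum
    simp only [List.map_cons, List.sum_cons, List.length_cons]
    push_cast
    linarith

/-- Truncating or padding a word to a given length changes its deviation by little. -/
theorem abs_disc_pad_le (σ : List Bool) {p : ℝ} (h0 : 0 ≤ p) (h1 : p ≤ 1) (x : List Bool) (n : ℕ) :
    |disc σ p ((List.range n).map fun i => x.getD i false)| ≤
      |disc σ p x| + |(x.length : ℝ) - n| + σ.length := by
  rcases le_total n x.length with h | h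
  · have hw : ((List.range n).map fun i => x.getD i false) = x.take n := by
      apply List.ext_getElem (by simp [h])
      intro i hi hi'
      have : i < x.length := by simp at hi'; omega
      simp [this]
    have h3 := abs_disc_left_le σ p (x.take n) (x.drop n)
    have h4 := abs_disc_le_length σ h0 h1 (x.drop n)
    rw [List.take_append_drop] at h3
    rw [List.length_drop, Nat.cast_sub h] at h4
    rw [hw]
    linarith [le_abs_self ((x.length : ℝ) - n)]
  · have hw : ((List.range n).map fun i => x.getD i false) =
        x ++ List.replicate (n - x.length) false := by
      apply List.ext_getElem (by simp [h])
      intro i hi hi'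
      rcases lt_or_ge i x.length with hx | hx
      · simp [hx]
      · simp [List.getElem_append_right hx, hx]
    have h3 := abs_disc_append_le σ p x (List.replicate (n - x.length) false)
    have h4 := abs_disc_le_length σ h0 h1 (List.replicate (n - x.length) false)
    rw [List.length_replicate, Nat.cast_sub h] at h4
    rw [hw]
    linarith [neg_le_abs ((x.length : ℝ) - n)]

/-! ### Words, cylinders and integrals -/

theorem length_of_mem_words {N : ℕ} {u : List Bool} (h : u ∈ words N) : u.length = N := by
  induction N generalizing u with
  | zero => simp_all [words]
  | succ N ih =>
    simp only [words, List.mem_append, List.mem_map] at h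
    rcases h with ⟨v, hv, rfl⟩ | ⟨v, hv, rfl⟩ <;> simp [ih hv]

theorem length_words (N : ℕ) : (words N).length = 2 ^ N := by
  induction N with
  | zero => rfl
  | succ N ih => simp [words, ih, pow_succ, mul_two]

theorem mem_cylinder_cons {b : Bool} {σ : List Bool} {ω : ℕ → Bool} :
    ω ∈ cylinder (b :: σ) ↔ ω 0 = b ∧ shift ω ∈ cylinder σ := by
  constructor
  · intro h
    exact ⟨h 0 (by simp), fun i hi => h (i + 1) (by simpa using hi)⟩
  · rintro ⟨h0, h⟩ i hi
    cases i with
    | zero => exact h0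
    | succ i => exact h i (by simpa using hi)

theorem mem_cylinder_nil {ω : ℕ → Bool} : ω ∈ cylinder [] := fun i hi => by simp at hi

theorem measurable_shift : Measurable shift :=
  measurable_pi_lambda _ fun n => measurable_pi_apply (n + 1)

theorem measurableSet_cylinder (σ : List Bool) : MeasurableSet (cylinder σ) := by
  induction σ with
  | nil => convert MeasurableSet.univ; exact Set.eq_univ_of_forall fun _ => mem_cylinder_nil
  | cons b σ ih =>
    have : cylinder (b :: σ) = (fun ω : ℕ → Bool => ω 0) ⁻¹' {b} ∩ shift ⁻¹' cylinder σ := by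
      ext ω; exact mem_cylinder_cons
    rw [this]
    exact (measurable_pi_apply 0 (measurableSet_singleton b)).inter (measurable_shift ih)

/-- The initial segment of length `n` of an infinite sequence. -/
def firstBits : ℕ → (ℕ → Bool) → List Bool
  | 0, _ => []
  | n + 1, ω => ω 0 :: firstBits n (shift ω)

theorem length_firstBits (n : ℕ) (ω : ℕ → Bool) : (firstBits n ω).length = n := by
  induction n generalizing ω with
  | zero => rfl
  | succ n ih => simp [firstBits, ih]

theorem getElem_firstBits {n : ℕ} {ω : ℕ → Bool} {i : ℕ} (h : i < (firstBits n ω).length) :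
    (firstBits n ω)[i] = ω i := by
  induction n generalizing ω i with
  | zero => simp [firstBits] at h
  | succ n ih =>
    cases i with
    | zero => rfl
    | succ i => simpa [firstBits, shift] using ih (ω := shift ω) (i := i) (by simpa [firstBits] using h)

theorem mem_cylinder_of_prefix {σ : List Bool} {n : ℕ} {ω : ℕ → Bool}
    (h : σ <+: firstBits n ω) : ω ∈ cylinder σ := fun i hi => by
  rw [h.getElem hi, getElem_firstBits]

theorem prefix_of_mem_cylinder {σ : List Bool} {n : ℕ} {ω : ℕ → Bool} (hn : σ.length ≤ n)
    (h : ω ∈ cylinder σ) : σ <+: firstBits n ω := by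
  rw [List.prefix_iff_eq_take]
  apply List.ext_getElem (by simp [length_firstBits, hn])
  intro i hi hi'
  simp [getElem_firstBits, h i hi]

/-- The number of `i < n` such that `σ` occurs in `ω` at position `i`. -/
noncomputable def visits (σ : List Bool) (n : ℕ) (ω : ℕ → Bool) : ℝ :=
  ∑ i ∈ Finset.range n, (cylinder σ).indicator (fun _ => (1 : ℝ)) (shift^[i] ω)

theorem visits_succ (σ : List Bool) (n : ℕ) (ω : ℕ → Bool) :
    visits σ (n + 1) ω =
      (cylinder σ).indicator (fun _ => (1 : ℝ)) ω + visits σ n (shift ω) := by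
  simp [visits, Finset.sum_range_succ', add_comm]

theorem occ_le_visits (σ : List Bool) (n : ℕ) (ω : ℕ → Bool) :
    occ σ (firstBits n ω) ≤ visits σ n ω := by
  induction n generalizing ω with
  | zero => simp [visits, firstBits, occ]
  | succ n ih =>
    rw [visits_succ]
    simp only [firstBits, occ]
    push_cast
    refine add_le_add ?_ (ih _)
    split_ifs with h
    · rw [Set.indicator_of_mem (mem_cylinder_of_prefix (n := n + 1) h)]
    · exact Set.indicator_nonneg (by simp) _

/-- A visit before time `n` that is not an occurrence in the first `n` bits must start within the
last `σ.length` positions. -/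
theorem visits_le_occ_add (σ : List Bool) (n : ℕ) (ω : ℕ → Bool) :
    visits σ n ω ≤ occ σ (firstBits n ω) + (min n σ.length : ℕ) := by
  induction n generalizing ω with
  | zero => simp [visits, firstBits, occ]
  | succ n ih =>
    have ih := ih (shift ω)
    have hi : (cylinder σ).indicator (fun _ => (1 : ℝ)) ω ≤ 1 :=
      Set.indicator_le_self' (by simp) _
    rw [visits_succ]
    simp only [firstBits, occ]
    rcases lt_or_ge n σ.length with h | h
    · rw [min_eq_left (by omega)] at ih ⊢
      push_cast
      split_ifs <;> linarith
    · rw [min_eq_right (by omega)] at ih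
      rw [min_eq_right (by omega)]
      push_cast
      by_cases hω : ω ∈ cylinder σ
      · have : σ <+: ω 0 :: firstBits n (shift ω) :=
          prefix_of_mem_cylinder (n := n + 1) (by omega) hω
        rw [if_pos this]
        linarith
      · rw [Set.indicator_of_notMem hω]
        split_ifs <;> linarith

theorem abs_occ_sub_visits_le (σ : List Bool) (n : ℕ) (ω : ℕ → Bool) :
    |(occ σ (firstBits n ω) : ℝ) - visits σ n ω| ≤ σ.length := by
  have h1 := occ_le_visits σ n ω
  have h2 := visits_le_occ_add σ n ω
  have h3 : ((min n σ.length : ℕ) : ℝ) ≤ σ.length := by exact_mod_cast min_le_right _ _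
  rw [abs_le]
  constructor <;> linarith [Nat.cast_nonneg (α := ℝ) σ.length]

/-- A function of the first `N` bits is a combination of indicators of cylinders. -/
theorem apply_firstBits (N : ℕ) (f : List Bool → ℝ) (ω : ℕ → Bool) :
    f (firstBits N ω) =
      ((words N).map fun u => (cylinder u).indicator (fun _ => f u) ω).sum := by
  induction N generalizing f ω with
  | zero => simp [firstBits, words, mem_cylinder_nil]
  | succ N ih =>
    have hind (b : Bool) (u : List Bool) : (cylinder (b :: u)).indicator (fun _ => f (b :: u)) ω =
        if ω 0 = b then (cylinder u).indicator (fun _ => f (b :: u)) (shift ω) else 0 := by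
      classical
      simp only [Set.indicator_apply, mem_cylinder_cons, ite_and]
    simp only [firstBits, words, List.map_append, List.map_map, List.sum_append,
      Function.comp_def, hind, ih fun u => f (ω 0 :: u)]
    cases ω 0 <;> simp

theorem integrable_list_sum {Ω ι : Type*} [MeasurableSpace Ω] {μ : Measure Ω} {l : List ι}
    {g : ι → Ω → ℝ} (hg : ∀ i, Integrable (g i) μ) :
    Integrable (fun ω => (l.map fun i => g i ω).sum) μ := by
  induction l with
  | nil => simp
  | cons i l ih =>
    simp only [List.map_cons, List.sum_cons]
    exact (hg i).add ih

theorem integral_list_sum {Ω ι : Type*} [MeasurableSpace Ω] {μ : Measure Ω} {l : List ι}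
    {g : ι → Ω → ℝ} (hg : ∀ i, Integrable (g i) μ) :
    ∫ ω, (l.map fun i => g i ω).sum ∂μ = (l.map fun i => ∫ ω, g i ω ∂μ).sum := by
  induction l with
  | nil => simp
  | cons i l ih =>
    simp only [List.map_cons, List.sum_cons]
    rw [integral_add (hg i) (integrable_list_sum hg), ih]

section measure

variable {μ : Measure (ℕ → Bool)} [IsProbabilityMeasure μ]

theorem integrable_indicator_cylinder (u : List Bool) (a : ℝ) :
    Integrable ((cylinder u).indicator fun _ => a) μ :=
  (integrable_const a).indicator (measurableSet_cylinder u)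

theorem integrable_firstBits (N : ℕ) (f : List Bool → ℝ) :
    Integrable (fun ω => f (firstBits N ω)) μ := by
  simp only [apply_firstBits N f]
  exact integrable_list_sum fun u => integrable_indicator_cylinder u (f u)

theorem integral_firstBits (N : ℕ) (f : List Bool → ℝ) :
    ∫ ω, f (firstBits N ω) ∂μ =
      ((words N).map fun u => μ.real (cylinder u) * f u).sum := by
  simp only [apply_firstBits N f]
  rw [integral_list_sum fun u => integrable_indicator_cylinder u (f u)]
  simp [integral_indicator_const, measurableSet_cylinder]

theorem sum_measure_cylinder_words (N : ℕ) :
    ((words N).map fun u => μ.real (cylinder u)).sum = 1 := by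
  simpa using (integral_firstBits (μ := μ) N fun _ => 1).symm

theorem indicator_shift_iterate (σ : List Bool) (i : ℕ) :
    (fun ω => (cylinder σ).indicator (fun _ => (1 : ℝ)) (shift^[i] ω)) =
      (shift^[i] ⁻¹' cylinder σ).indicator fun _ => 1 := rfl

theorem integrable_visits (σ : List Bool) (n : ℕ) : Integrable (visits σ n) μ := by
  refine integrable_finsetSum _ fun i _ => ?_
  rw [indicator_shift_iterate]
  exact (integrable_const 1).indicator (measurable_shift.iterate i (measurableSet_cylinder σ))

theorem integral_visits (hμ : MeasurePreserving shift μ μ) (σ : List Bool) (n : ℕ) :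
    ∫ ω, visits σ n ω ∂μ = n * μ.real (cylinder σ) := by
  have hm (i : ℕ) := measurable_shift.iterate i (measurableSet_cylinder σ)
  simp only [visits]
  rw [integral_finsetSum]
  · simp only [indicator_shift_iterate]
    simp only [integral_indicator_const _ (hm _), measureReal_def,
      (hμ.iterate _).measure_preimage (measurableSet_cylinder σ).nullMeasurableSet]
    simp
  · intro i _
    rw [indicator_shift_iterate]
    exact (integrable_const 1).indicator (hm i)

/-- By invariance, the deviation of `σ` in words of length `N` has almost mean zero. -/
theorem abs_mean_disc_le (hμ : MeasurePreserving shift μ μ) (σ : List Bool) (N : ℕ) :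
    |((words N).map fun u => μ.real (cylinder u) * disc σ (μ.real (cylinder σ)) u).sum| ≤
      σ.length := by
  -- The integral of `visits` is `N * μ[σ]`, so only the boundary effect `occ - visits` is left,
  -- which is bounded pointwise.
  have h : ∫ ω, disc σ (μ.real (cylinder σ)) (firstBits N ω) ∂μ =
      ∫ ω, ((occ σ (firstBits N ω) : ℝ) - visits σ N ω) ∂μ := by
    simp only [disc, length_firstBits]
    rw [integral_sub (integrable_firstBits N fun x => (occ σ x : ℝ)) (integrable_const _),
      integral_sub (integrable_firstBits N fun x => (occ σ x : ℝ)) (integrable_visits σ N),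
      integral_visits hμ]
    simp
  rw [← integral_firstBits, h]
  simpa using norm_integral_le_of_norm_le_const (μ := μ)
    (ae_of_all _ fun ω => (Real.norm_eq_abs _).trans_le (abs_occ_sub_visits_le σ N ω))

end measure

/-! ### Blocks have the frequencies of the measure -/

section represented

variable {μ : Measure (ℕ → Bool)} {r : List Bool × ℕ → ℚ} {o : ℕ → ℕ}

theorem multiplicity_eq (ho : Encodes o r) (N : ℕ) (u : List Bool) :
    multiplicity o N u = ⌊4 ^ N * max (r (u, 2 * N)) 0⌋₊ := by
  rw [← ho (u, 2 * N), max_ratOfNat_zero, ← mul_div_assoc, multiplicity]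
  exact_mod_cast (Nat.floor_div_eq_div (K := ℚ) _ _).symm

/-- Rounding down costs at most `1`; the oracle's error of `4⁻¹ ^ N`, scaled by `4 ^ N`, costs
another `1`. Clipping at `0` does no harm since measures are nonnegative. -/
theorem abs_multiplicity_sub_le (hr : Represents r μ) (ho : Encodes o r) (N : ℕ) (u : List Bool) :
    |(multiplicity o N u : ℝ) - 4 ^ N * μ.real (cylinder u)| ≤ 2 := by
  have hM : (0 : ℝ) < 4 ^ N := by positivity
  set q : ℝ := max (r (u, 2 * N) : ℝ) 0 with hq
  have hnonneg : 0 ≤ 4 ^ N * max (r (u, 2 * N)) 0 := by positivity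
  have h1 : (multiplicity o N u : ℝ) ≤ 4 ^ N * q := by
    rw [multiplicity_eq ho, hq]
    exact_mod_cast Nat.floor_le hnonneg
  have h2 : 4 ^ N * q < multiplicity o N u + 1 := by
    rw [multiplicity_eq ho, hq]
    exact_mod_cast Nat.lt_floor_add_one (4 ^ N * max (r (u, 2 * N)) 0)
  have h3 : |q - μ.real (cylinder u)| ≤ (4 ^ N : ℝ)⁻¹ := by
    have h := (hr u (2 * N)).le
    have h4 : (2 : ℝ)⁻¹ ^ (2 * N) = (4 ^ N : ℝ)⁻¹ := by
      rw [pow_mul, ← inv_pow]; norm_num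
    rw [abs_sub_comm, h4] at h
    refine le_trans ?_ h
    have := abs_max_sub_max_le_abs (r (u, 2 * N) : ℝ) (μ.real (cylinder u)) 0
    rwa [max_eq_left (measureReal_nonneg (μ := μ) (s := cylinder u))] at this
  have h4 : |4 ^ N * q - 4 ^ N * μ.real (cylinder u)| ≤ 1 := by
    rw [← mul_sub, abs_mul, abs_of_pos hM]
    calc _ ≤ 4 ^ N * (4 ^ N : ℝ)⁻¹ := by gcongr
      _ = 1 := mul_inv_cancel₀ hM.ne'
  rw [abs_le] at *
  constructor <;> linarith

theorem list_sum_map_sub {α : Type*} (l : List α) (f g : α → ℝ) :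
    (l.map fun u => f u - g u).sum = (l.map f).sum - (l.map g).sum := by
  induction l with
  | nil => simp
  | cons u l ih => simp only [List.map_cons, List.sum_cons, ih]; ring

variable [IsProbabilityMeasure μ]

theorem abs_sum_multiplicity_sub_le (hr : Represents r μ) (ho : Encodes o r) (N : ℕ) :
    |((words N).map fun u => (multiplicity o N u : ℝ)).sum - 4 ^ N| ≤ 2 ^ N * 2 := by
  have h := abs_list_sum_le (l := words N) fun u _ => abs_multiplicity_sub_le hr ho N u
  rw [list_sum_map_sub, List.sum_map_mul_left, sum_measure_cylinder_words, length_words] at h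
  simpa using h

theorem abs_sum_multiplicity_mul_disc_le (hμ : MeasurePreserving shift μ μ)
    (hr : Represents r μ) (ho : Encodes o r) (σ : List Bool) (N : ℕ) :
    |((words N).map fun u => multiplicity o N u * disc σ (μ.real (cylinder σ)) u).sum| ≤
      2 ^ N * (2 * N) + 4 ^ N * σ.length := by
  set p := μ.real (cylinder σ) with hp
  -- Replacing each multiplicity by its ideal value costs at most `2` times the deviation of a word,
  -- which is at most `N`.
  have h := abs_list_sum_le (l := words N) (B := 2 * (N : ℝ))
    (f := fun u => multiplicity o N u * disc σ p u -
      4 ^ N * (μ.real (cylinder u) * disc σ p u)) fun u hu => by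
    rw [← mul_assoc, ← sub_mul, abs_mul]
    have h1 := abs_disc_le_length σ (p := p) measureReal_nonneg measureReal_le_one u
    rw [length_of_mem_words hu] at h1
    exact mul_le_mul (abs_multiplicity_sub_le hr ho N u) h1 (abs_nonneg _) (by norm_num)
  rw [list_sum_map_sub, List.sum_map_mul_left, length_words] at h
  have h2 := mul_le_mul_of_nonneg_left (abs_mean_disc_le hμ σ N) (by positivity : (0 : ℝ) ≤ 4 ^ N)
  rw [← abs_of_pos (by positivity : (0 : ℝ) < 4 ^ N), ← abs_mul,
    abs_of_pos (by positivity : (0 : ℝ) < 4 ^ N), ← hp] at h2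
  push_cast at h
  rw [abs_le] at *
  constructor <;> linarith

theorem length_block (o : ℕ → ℕ) (t : ℕ) : (block o t).length = blockLength t := by
  simp [block]

theorem abs_disc_block_add_le (hμ : MeasurePreserving shift μ μ)
    (hr : Represents r μ) (ho : Encodes o r) (σ : List Bool) (t : ℕ) :
    (t + 1) * (|disc σ (μ.real (cylinder σ)) (block o t)| + σ.length) ≤
      (6 * σ.length + 4) * blockLength t := by
  set p := μ.real (cylinder σ)
  obtain ⟨N, hN⟩ : ∃ N, N = t + 1 := ⟨_, rfl⟩
  have hN' : (N : ℝ) = t + 1 := by simp [hN]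
  set k : ℝ := (σ.length : ℝ) with hk
  have hk0 : 0 ≤ k := by positivity
  set C := ((words N).map fun u => (multiplicity o N u : ℝ)).sum with hC
  have hC1 : |C - 4 ^ N| ≤ 2 ^ N * 2 := abs_sum_multiplicity_sub_le hr ho N
  have hlen : ((sample o N).length : ℝ) = C * N :=
    length_flatMap_listRepeat _ fun u => length_of_mem_words
  have h1 := abs_disc_flatMap_listRepeat_sub σ p (multiplicity o N) (words N)
  have h2 := abs_sum_multiplicity_mul_disc_le hμ hr ho σ N
  have h3 := abs_disc_pad_le σ (p := p) measureReal_nonneg measureReal_le_one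
    (sample o N) (blockLength t)
  have hL : (blockLength t : ℝ) = N * 4 ^ N := by simp [blockLength, hN]
  have hblock : ((List.range (blockLength t)).map fun i => (sample o N).getD i false) =
      block o t := by rw [hN]; rfl
  have h4 : |((sample o N).length : ℝ) - blockLength t| ≤ 2 ^ N * 2 * N := by
    rw [hlen, hL, mul_comm (N : ℝ), ← sub_mul, abs_mul, Nat.abs_cast]
    gcongr
  have h24 : (2 : ℝ) ^ N ≤ 4 ^ N := by gcongr; norm_num
  have h2N : (2 : ℝ) ^ N * N ≤ 4 ^ N := by
    have : (N : ℝ) ≤ 2 ^ N := by exact_mod_cast Nat.lt_two_pow_self.le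
    calc (2 : ℝ) ^ N * N ≤ 2 ^ N * 2 ^ N := by gcongr
      _ = 4 ^ N := by rw [← mul_pow]; norm_num
  have hone : (1 : ℝ) ≤ 4 ^ N := one_le_pow₀ (by norm_num)
  have hCk : C * k ≤ 3 * 4 ^ N * k := by
    have := (abs_le.1 hC1).2
    gcongr
    linarith
  have hsample : |disc σ p (sample o N)| ≤ C * k + (2 ^ N * (2 * N) + 4 ^ N * k) := by
    have := abs_add_le (disc σ p (sample o N) -
      ((words N).map fun u => multiplicity o N u * disc σ p u).sum)
      ((words N).map fun u => multiplicity o N u * disc σ p u).sum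
    rw [sub_add_cancel] at this
    exact this.trans (add_le_add h1 h2)
  rw [hblock] at h3
  have hk4 : k ≤ 4 ^ N * k := le_mul_of_one_le_left hk0 hone
  -- In units of `4 ^ N`, with `2 ^ N * N ≤ 4 ^ N`: the sample contributes `4 * k + 2`, the padding
  -- `k + 2`, and the added `σ.length` at most `k`.
  rw [hL, ← hN', mul_left_comm]
  gcongr
  linarith

end represented

/-! ### The frequencies in the constructed point -/

theorem length_initialWord (o : ℕ → ℕ) (s : ℕ) : (initialWord o s).length = initialLength s := by
  induction s with
  | zero => rfl
  | succ s ih => simp [initialWord, initialLength, length_listRepeat, length_block, ih]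

theorem lt_blockLength (s : ℕ) : s < blockLength s :=
  Nat.lt_of_lt_of_le (Nat.lt_succ_self s) (Nat.le_mul_of_pos_right _ (by positivity))

theorem le_initialLength (s : ℕ) : s ≤ initialLength s := by
  induction s with
  | zero => exact le_rfl
  | succ s ih =>
    have h : 0 < blockLength (s + 1) * blockLength s :=
      Nat.mul_pos (by simp [blockLength]) (by simp [blockLength])
    simp only [initialLength]
    omega

theorem blockLength_mul_le_initialLength {t s : ℕ} (h : t < s) :
    blockLength s * (t + 1) ≤ initialLength s := by
  obtain ⟨s, rfl⟩ : ∃ s', s = s' + 1 := ⟨s - 1, by omega⟩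
  have := lt_blockLength s
  exact (Nat.mul_le_mul_left _ (by omega)).trans (Nat.le_add_left _ _)

theorem initialWord_prefix (o : ℕ → ℕ) {s t : ℕ} (h : s ≤ t) :
    initialWord o s <+: initialWord o t := by
  induction t, h using Nat.le_induction with
  | base => exact List.prefix_rfl
  | succ t _ ih => exact ih.trans (List.prefix_append _ _)

theorem point_eq_getElem (o : ℕ → ℕ) {s i : ℕ} (h : i < (initialWord o s).length) :
    point o i = (initialWord o s)[i] := by
  have hi : i < (initialWord o (i + 1)).length := by
    rw [length_initialWord]
    exact le_initialLength (i + 1)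
  rw [point, List.getD_eq_getElem _ _ hi]
  rcases le_total s (i + 1) with hs | hs
  · exact ((initialWord_prefix o hs).getElem h).symm
  · exact (initialWord_prefix o hs).getElem hi

theorem firstBits_point (o : ℕ → ℕ) {n s : ℕ} (h : n ≤ initialLength s) :
    firstBits n (point o) = (initialWord o s).take n := by
  apply List.ext_getElem (by simp [length_firstBits, length_initialWord, h])
  intro i hi hi'
  rw [getElem_firstBits, List.getElem_take, ← point_eq_getElem]

section discrepancy

variable {o : ℕ → ℕ} {σ : List Bool} {p η : ℝ} {t : ℕ}

/-- The summand `σ.length` in `hη` pays for the junction at each copy of a block. What precedes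
stage `t` is estimated trivially by its length. -/
theorem abs_disc_initialWord_le (h0 : 0 ≤ p) (h1 : p ≤ 1)
    (hη : ∀ s, t ≤ s → |disc σ p (block o s)| + σ.length ≤ η * blockLength s) (hη0 : 0 ≤ η)
    {s : ℕ} (hs : t ≤ s) :
    |disc σ p (initialWord o s)| ≤ initialLength t + η * initialLength s := by
  induction s, hs using Nat.le_induction with
  | base =>
    have := abs_disc_le_length σ h0 h1 (initialWord o t)
    rw [length_initialWord] at this
    have : 0 ≤ η * initialLength t := by positivity
    linarith
  | succ s hs ih =>
    have h := abs_disc_append_listRepeat_le σ p (blockLength (s + 1)) (initialWord o s) (block o s)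
    have h2 := mul_le_mul_of_nonneg_left (hη s hs) (Nat.cast_nonneg (blockLength (s + 1)))
    simp only [initialWord, initialLength]
    push_cast
    linarith

theorem abs_disc_firstBits_point_le (h0 : 0 ≤ p) (h1 : p ≤ 1)
    (hη : ∀ s, t ≤ s → |disc σ p (block o s)| + σ.length ≤ η * blockLength s) (hη0 : 0 ≤ η)
    {s n : ℕ} (hs : t ≤ s) (hn : initialLength s ≤ n) (hn' : n ≤ initialLength (s + 1)) :
    |disc σ p (firstBits n (point o))| ≤
      initialLength t + η * n + blockLength s + σ.length := by
  obtain ⟨q, b, hqb⟩ := exists_take_listRepeat (block o s) (blockLength (s + 1))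
    (n - initialLength s)
  have hw : firstBits n (point o) =
      initialWord o s ++ listRepeat q (block o s) ++ (block o s).take b := by
    rw [firstBits_point o hn', initialWord, List.take_append, length_initialWord, hqb,
      List.take_of_length_le (by rwa [length_initialWord]), List.append_assoc]
  have hlen : initialLength s + q * blockLength s ≤ n := by
    have := congrArg List.length hw
    simp only [length_firstBits, List.length_append, length_initialWord, length_listRepeat,
      length_block] at this
    omega
  have hlen' : (initialLength s + q * blockLength s : ℝ) ≤ n := by exact_mod_cast hlen
  have hb : (((block o s).take b).length : ℝ) ≤ blockLength s := by
    rw [← length_block o s]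
    exact_mod_cast List.length_take_le' b (block o s)
  have e1 := abs_disc_append_le σ p (initialWord o s ++ listRepeat q (block o s))
    ((block o s).take b)
  have e2 := abs_disc_append_listRepeat_le σ p q (initialWord o s) (block o s)
  have e3 := abs_disc_initialWord_le h0 h1 hη hη0 hs
  have e4 := abs_disc_le_length σ h0 h1 ((block o s).take b)
  have e5 := mul_le_mul_of_nonneg_left (hη s hs) (Nat.cast_nonneg q)
  have e6 := mul_le_mul_of_nonneg_left hlen' hη0
  rw [hw]
  linarith

end discrepancy

/-! ### The explicit modulus and the final estimate. -/

/-- The stage of the construction from which on the frequencies are accurate. -/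
def accuracyStage (j K : ℕ) : ℕ := (6 * j + 6) * (K + 1)

/-- The length from which on the frequencies of words of length `j` are accurate up to every
`ε` with `⌊ε⁻¹⌋₊ = K`. -/
def modulus (j K : ℕ) : ℕ :=
  (accuracyStage j K + 1) * (initialLength (accuracyStage j K + 1) + 2 * j)

theorem primrec_modulus : Primrec₂ modulus := by
  have hs : Primrec fun q : ℕ × ℕ => accuracyStage q.1 q.2 :=
    Primrec.nat_mul.comp
      (Primrec.nat_add.comp (Primrec.nat_mul.comp (Primrec.const 6) Primrec.fst)
        (Primrec.const 6))
      (Primrec.succ.comp Primrec.snd)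
  exact Primrec.nat_mul.comp (Primrec.succ.comp hs)
    (Primrec.nat_add.comp (primrec_initialLength.comp (Primrec.succ.comp hs))
      (Primrec.nat_mul.comp (Primrec.const 2) Primrec.fst))

theorem computable_modulus_ratOfNat :
    Computable₂ fun j e : ℕ => modulus j ⌊(ratOfNat e)⁻¹⌋₊ := by
  simp only [floor_inv_ratOfNat]
  exact (primrec_modulus.comp Primrec.fst (Primrec.nat_div.comp
    (primrec_codeDen.comp Primrec.snd) (primrec_codeNum.comp Primrec.snd))).to_comp

theorem exists_initialLength_le_lt {a n : ℕ} (h : initialLength a ≤ n) :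
    ∃ s, a ≤ s ∧ initialLength s ≤ n ∧ n ≤ initialLength (s + 1) := by
  by_contra! hcon
  have key : ∀ s, a ≤ s → initialLength s ≤ n := by
    intro s hs
    induction s, hs using Nat.le_induction with
    | base => exact h
    | succ s hs ih => exact (hcon s hs ih).le
  have := key (max a (n + 1)) (le_max_left _ _)
  have h' := le_initialLength (max a (n + 1))
  omega

theorem abs_measure_sub_freq_point_lt {μ : Measure (ℕ → Bool)} [IsProbabilityMeasure μ]
    {r : List Bool × ℕ → ℚ} {o : ℕ → ℕ} (hμ : MeasurePreserving shift μ μ)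
    (hr : Represents r μ) (ho : Encodes o r) (σ : List Bool) {ε : ℚ} (hε : 0 < ε) {n : ℕ}
    (hn : modulus σ.length ⌊ε⁻¹⌋₊ ≤ n) :
    |μ.real (cylinder σ) - freq σ (point o) n| < (ε : ℝ) := by
  set p := μ.real (cylinder σ) with hp
  set K := ⌊ε⁻¹⌋₊ with hK
  set t := accuracyStage σ.length K with ht
  set k : ℝ := (σ.length : ℝ) with hk
  have hk0 : 0 ≤ k := by positivity
  have hmod : (t + 1) * (initialLength (t + 1) + 2 * σ.length) ≤ n := hn
  have hT : (0 : ℝ) < t + 1 := by positivity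
  -- The strict inequality `t < s` is needed to bound `blockLength s` by `n / (t + 1)`; it also
  -- makes `n` positive.
  obtain ⟨s, hs, hsn, hsn'⟩ : ∃ s, t + 1 ≤ s ∧ initialLength s ≤ n ∧
      n ≤ initialLength (s + 1) := exists_initialLength_le_lt (by nlinarith)
  have hn0 : (0 : ℝ) < n := by
    have := le_initialLength s
    exact_mod_cast (by omega : 0 < n)
  have hη : ∀ s, t ≤ s → |disc σ p (block o s)| + σ.length ≤
      (6 * k + 4) / (t + 1) * blockLength s := by
    intro s hs
    have h := abs_disc_block_add_le hμ hr ho σ s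
    have hts : (t + 1 : ℝ) ≤ s + 1 := by exact_mod_cast Nat.succ_le_succ hs
    rw [div_mul_eq_mul_div, le_div_iff₀ hT, mul_comm]
    refine le_trans ?_ h
    gcongr
  have hdisc := abs_disc_firstBits_point_le (p := p) measureReal_nonneg measureReal_le_one hη
    (by positivity) (by omega : t ≤ s) hsn hsn'
  have hvis := abs_occ_sub_visits_le σ n (point o)
  rw [disc, length_firstBits] at hdisc
  -- One `k` comes from the junction with the unfinished block, the other from comparing `occ` with
  -- `visits`.
  have hP : (initialLength t : ℝ) + 2 * k ≤ n / (t + 1) := by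
    rw [le_div_iff₀ hT, mul_comm]
    have h1 : initialLength t ≤ initialLength (t + 1) := Nat.le_add_right _ _
    have h2 : (t + 1) * (initialLength t + 2 * σ.length) ≤ n :=
      (Nat.mul_le_mul_left _ (by omega)).trans hmod
    rw [hk]
    exact_mod_cast h2
  have hl : (blockLength s : ℝ) ≤ n / (t + 1) := by
    rw [le_div_iff₀ hT]
    exact_mod_cast (blockLength_mul_le_initialLength hs).trans hsn
  -- The total is `6 * k + 4` from the complete blocks, `1` from the unfinished block and `1` from
  -- the terms in `hP`. It beats `ε` because `ε * (K + 1) > 1`.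
  have hstage : (6 * k + 6) / (t + 1) < ε := by
    have h1 : (ε : ℝ)⁻¹ < K + 1 := by
      exact_mod_cast Nat.lt_floor_add_one ε⁻¹
    have hε' : (0 : ℝ) < ε := by exact_mod_cast hε
    have h2 : 1 < ε * (K + 1 : ℝ) := by
      rwa [inv_lt_iff_one_lt_mul₀' hε'] at h1
    have h3 : (t : ℝ) = (6 * k + 6) * (K + 1) := by simp [ht, accuracyStage, hk]
    rw [div_lt_iff₀ hT, h3]
    nlinarith
  have hmain : |n * p - visits σ n (point o)| < ε * n := by
    have h1 : |n * p - visits σ n (point o)| ≤ (6 * k + 6) / (t + 1) * n := by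
      have e : (6 * k + 6) / (t + 1) * n =
          (6 * k + 4) / (t + 1) * n + n / (t + 1) + n / (t + 1) := by ring
      rw [e]
      rw [abs_le] at *
      constructor <;> linarith
    exact h1.trans_lt (by gcongr)
  have hfreq : p - freq σ (point o) n = (n * p - visits σ n (point o)) / n := by
    rw [freq, visits]
    field_simp
  rw [hfreq, abs_div, Nat.abs_cast, div_lt_iff₀ hn0]
  exact hmain

theorem isGeneric_point {μ : Measure (ℕ → Bool)} [IsProbabilityMeasure μ]
    {r : List Bool × ℕ → ℚ} {o : ℕ → ℕ} (hμ : MeasurePreserving shift μ μ)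
    (hr : Represents r μ) (ho : Encodes o r) : IsGeneric μ (point o) := by
  intro σ
  rw [Metric.tendsto_atTop]
  intro ε hε
  obtain ⟨q, hq0, hq⟩ := exists_rat_btwn hε
  refine ⟨modulus σ.length ⌊q⁻¹⌋₊, fun n hn => ?_⟩
  rw [dist_comm, Real.dist_eq]
  exact (abs_measure_sub_freq_point_lt hμ hr ho σ (by exact_mod_cast hq0) hn).trans hq

end CantorGeneric

theorem theorem4p2 :
    (∃ m : ℕ → ℚ → ℕ,
      Computable₂ (fun j e : ℕ => m j (CantorGeneric.ratOfNat e)) ∧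
      ∃ F : (ℕ → ℕ) → ℕ →. ℕ, CantorGeneric.OracleAlgorithm F ∧
        ∀ (μ : MeasureTheory.Measure (ℕ → Bool)) [MeasureTheory.IsProbabilityMeasure μ],
          MeasureTheory.MeasurePreserving CantorGeneric.shift μ μ →
          ∀ r : List Bool × ℕ → ℚ, CantorGeneric.Represents r μ →
          ∀ o : ℕ → ℕ, CantorGeneric.Encodes o r →
          ∃ ω : ℕ → Bool,
            CantorGeneric.ComputesPoint F o ω ∧
            CantorGeneric.IsGeneric μ ω ∧
            ∀ (j : ℕ) (σ : List Bool), σ.length = j →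
              ∀ ε : ℚ, 0 < ε → ∀ n : ℕ, m j ε ≤ n →
                |μ.real (CantorGeneric.cylinder σ) - CantorGeneric.freq σ ω n| < (ε : ℝ)) ∧
    (∀ (μ : MeasureTheory.Measure (ℕ → Bool)) [MeasureTheory.IsProbabilityMeasure μ],
      MeasureTheory.MeasurePreserving CantorGeneric.shift μ μ →
      CantorGeneric.ComputableMeasure μ →
      ∃ ω : ℕ → Bool, Computable ω ∧ CantorGeneric.IsGeneric μ ω) := by
  obtain ⟨F, hF, hpoint⟩ := CantorGeneric.exists_oracleAlgorithm_point
  constructor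
  · refine ⟨fun j ε => CantorGeneric.modulus j ⌊ε⁻¹⌋₊,
      CantorGeneric.computable_modulus_ratOfNat, F, hF, fun μ _ hμ r hr o ho =>
      ⟨CantorGeneric.point o, hpoint o, CantorGeneric.isGeneric_point hμ hr ho, ?_⟩⟩
    rintro _ σ rfl ε hε n hn
    exact CantorGeneric.abs_measure_sub_freq_point_lt hμ hr ho σ hε hn
  · rintro μ _ hμ ⟨r, hr, o, ho, hor⟩
    exact ⟨CantorGeneric.point o, (hpoint o).computable hF ho,
      CantorGeneric.isGeneric_point hμ hr hor⟩
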